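/- For $P\in\mathbb S^n$ (real symmetric $n\times n$ matrices) let $\lambda_{\min}(P)$, $\lambda_{\max}(P)$ be its smallest and largest eigenvalues and let $$\|P\|_{\rm a}:=\max_{\Delta\in\mathbb S^n,\ \Delta\ne0}\frac{\|\Delta P-P\Delta\|}{\|\Delta\|},$$ where $\|\cdot\|$ is the spectral norm. Let $P_0,P_1\in\mathbb S^n$ be positive definite and let $\alpha\in\mathbb R$ satisfy $$|\alpha|<\max\left\{\frac{\lambda_{\min}(P_0)\lambda_{\min}(P_1)}{\|P_0\|_{\rm a}\,\lambda_{\max}(P_1)},\ \frac{\lambda_{\min}(P_0)\lambda_{\min}(P_1)}{\|P_1\|_{\rm a}\,\lambda_{\max}(P_0)}\right\},$$ where a quotient with $\|P_i\|_{\rm a}=0$ in its denominator is read as $+\infty$. Then there exists a unique $\Pi\in\mathbb S^n$ with $$e^{\alpha(P_0\Pi-\Pi P_0)}e^{-P_0\Pi}P_0e^{-\Pi P_0}e^{\alpha(\Pi P_0-P_0\Pi)}=P_1.$$ Consequently, if $\alpha=\frac{1+\epsilon}{2\epsilon}$ with a real $\epsilon\ne0$, there is a unique path $(P_t)_{t\in[0,1]}$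 with value $P_1$ at $t=1$ which is, for some $\Pi\in\mathbb S^n$, of the rotating-eigenspace form $P_t=T_tP_0T_t'$, where $$T_t=e^{(1+\epsilon)A_{\rm a}t}e^{(A_{\rm s}+\epsilon A_{\rm a}')t},\qquad A=-\tfrac12(P_0\Pi+\Pi P_0)-\tfrac1{2\epsilon}(\Pi P_0-P_0\Pi),$$ $A_{\rm s}=\frac12(A+A')$, $A_{\rm a}=\frac12(A-A')$, and $'$ denotes transpose. -/

import Mathlib

namespace CovPath

noncomputable section

/-- Smallest eigenvalue of a real symmetric matrix. -/
def lambdaMin {n : ℕ} (P : Matrix (Fin n) (Fin n) ℝ) : ℝ := sInf (spectrum ℝ P)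

/-- Largest eigenvalue of a real symmetric matrix. -/
def lambdaMax {n : ℕ} (P : Matrix (Fin n) (Fin n) ℝ) : ℝ := sSup (spectrum ℝ P)

section CommutatorNorm

open scoped Matrix.Norms.L2Operator

/-- The quotients `‖Δ P - P Δ‖ / ‖Δ‖` over nonzero symmetric `Δ`; here `‖·‖` is the spectral norm
(the operator norm induced by the Euclidean norm). -/
def commQuotients {n : ℕ} (P : Matrix (Fin n) (Fin n) ℝ) : Set ℝ :=
  {r | ∃ D : Matrix (Fin n) (Fin n) ℝ, D.IsSymm ∧ D ≠ 0 ∧ r = ‖D * P - P * D‖ / ‖D‖}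

/-- The commutator pseudo-norm `‖P‖_a`. -/
def commNorm {n : ℕ} (P : Matrix (Fin n) (Fin n) ℝ) : ℝ := sSup (commQuotients P)

/-- The set of quotients is bounded, so the supremum is the true one. -/
theorem bddAbove_commQuotients {n : ℕ} (P : Matrix (Fin n) (Fin n) ℝ) :
    BddAbove (commQuotients P) := by
  refine ⟨2 * ‖P‖, ?_⟩
  rintro r ⟨D, -, hD, rfl⟩
  rw [div_le_iff₀ (norm_pos_iff.mpr hD)]
  calc ‖D * P - P * D‖ ≤ ‖D * P‖ + ‖P * D‖ := norm_sub_le _ _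
    _ ≤ ‖D‖ * ‖P‖ + ‖P‖ * ‖D‖ := add_le_add (norm_mul_le _ _) (norm_mul_le _ _)
    _ = 2 * ‖P‖ * ‖D‖ := by ring

end CommutatorNorm

/-- The bound `λmin(P) λmin(R) / (‖P‖_a λmax(R))`, as an extended nonnegative real, so that it
is `∞` when `‖P‖_a = 0` (and `P`, `R` are positive definite of positive size). -/
def alphaBound {n : ℕ} (P R : Matrix (Fin n) (Fin n) ℝ) : ENNReal :=
  ENNReal.ofReal (lambdaMin P * lambdaMin R) / ENNReal.ofReal (commNorm P * lambdaMax R)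

/-- `h_{α,P₀}(Π)`, with `X` in the role of `Π`. -/
def hMap {n : ℕ} (α : ℝ) (P₀ X : Matrix (Fin n) (Fin n) ℝ) : Matrix (Fin n) (Fin n) ℝ :=
  NormedSpace.exp (α • (P₀ * X - X * P₀)) * NormedSpace.exp (-(P₀ * X)) * P₀ *
    NormedSpace.exp (-(X * P₀)) * NormedSpace.exp (α • (X * P₀ - P₀ * X))

/-- Symmetric part of a matrix. -/
def symPart {n : ℕ} (A : Matrix (Fin n) (Fin n) ℝ) : Matrix (Fin n) (Fin n) ℝ :=
  (1 / 2 : ℝ) • (A + A.transpose)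

/-- Antisymmetric part of a matrix. -/
def antiPart {n : ℕ} (A : Matrix (Fin n) (Fin n) ℝ) : Matrix (Fin n) (Fin n) ℝ :=
  (1 / 2 : ℝ) • (A - A.transpose)

/-- The state transition matrix `T_{ε,t}(A)`. -/
def transition {n : ℕ} (ε t : ℝ) (A : Matrix (Fin n) (Fin n) ℝ) : Matrix (Fin n) (Fin n) ℝ :=
  NormedSpace.exp (((1 + ε) * t) • antiPart A) *
    NormedSpace.exp (t • (symPart A + ε • (antiPart A).transpose))

/-- The initial system matrix `A₀` attached to an initial co-state `X`. -/
def initialSystem {n : ℕ} (ε : ℝ) (P₀ X : Matrix (Fin n) (Fin n) ℝ) :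
    Matrix (Fin n) (Fin n) ℝ :=
  -((1 / 2 : ℝ) • (P₀ * X + X * P₀)) - (1 / (2 * ε)) • (X * P₀ - P₀ * X)

/-- `P` is a rotating-eigenspace covariance path on `[0,1]` with parameter `ε`, started at `P₀`:
`P t = T_{ε,t}(A₀) P₀ T_{ε,t}(A₀)'` with `A₀` given by some symmetric initial co-state. -/
def IsRotationPath {n : ℕ} (ε : ℝ) (P₀ : Matrix (Fin n) (Fin n) ℝ)
    (P : unitInterval → Matrix (Fin n) (Fin n) ℝ) : Prop :=
  ∃ X : Matrix (Fin n) (Fin n) ℝ, X.IsSymm ∧ ∀ t : unitInterval,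
    P t = transition ε (t : ℝ) (initialSystem ε P₀ X) * P₀ *
      (transition ε (t : ℝ) (initialSystem ε P₀ X)).transpose

end

end CovPath

namespace CovPath

open NormedSpace
open scoped Matrix.Norms.L2Operator MatrixOrder ComplexOrder

variable {n : ℕ}

/-! Write `P`, `R` for the endpoints and `U = exp (α [P, X])`, which is orthogonal. The equation
says that `exp (-PX) P exp (-XP)` equals `Uᵀ R U`. With `S = P^(1/2)` and `T = S⁻¹` the left side is
`S exp (-2 SXS) S`, so solutions are the symmetric fixed points of `X ↦ -(1/2) T log (T Uᵀ R U T) T`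
(`hMap_eq_iff_steeringMap`).

This map is a contraction (`norm_steeringMap_sub_le`). On skew matrices `exp` is 1-Lipschitz, so `Uᵀ
R U` moves by at most `2 ‖R‖ |α| ‖P‖_a ‖X - Y‖`. As `Uᵀ R U ≥ λmin(R)`, this is a multiplicative
change in the Loewner order. Congruence by `T` preserves it, and operator monotonicity of `log`
makes it an additive bound with no condition number of `P` (`norm_sub_le_of_exp_le`). Banach's
theorem settles the first term of the maximum.

The second term follows by reversal: `reverseCostate` exchanges co-states from `P` to `R` with those
from `R` to `P`. For the path, the transition matrix at time 1 is `U exp (-PX)`, so the endpoint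
fixes `X`. -/

/-! ### Loewner order, exponential and logarithm -/

theorem posSemidef_map_ofReal_iff (A : Matrix (Fin n) (Fin n) ℝ) :
    (A.map ((↑) : ℝ → ℂ)).PosSemidef ↔ A.PosSemidef := by
  constructor
  · intro h
    refine Matrix.PosSemidef.of_dotProduct_mulVec_nonneg ?_ fun x => ?_
    · ext i j
      have := congrFun (congrFun h.1 i) j
      simpa using this
    · have := h.dotProduct_mulVec_nonneg (fun i => (x i : ℂ))
      have e : star (fun i => (x i : ℂ)) ⬝ᵥ (A.map ((↑) : ℝ → ℂ)).mulVec (fun i => (x i : ℂ))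
          = ((star x ⬝ᵥ A.mulVec x : ℝ) : ℂ) := by
        simp [dotProduct, Matrix.mulVec]
      rw [e] at this
      exact_mod_cast this
  · intro h
    obtain ⟨B, rfl⟩ := CStarAlgebra.nonneg_iff_eq_star_mul_self.mp
      (Matrix.nonneg_iff_posSemidef.mpr h)
    have e : (star B * B).map ((↑) : ℝ → ℂ)
        = (B.map ((↑) : ℝ → ℂ)).conjTranspose * B.map ((↑) : ℝ → ℂ) := by
      ext i j
      simp [Matrix.mul_apply, Matrix.star_eq_conjTranspose]
    rw [e]
    exact Matrix.posSemidef_conjTranspose_mul_self _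

theorem map_ofReal_le_iff (A B : Matrix (Fin n) (Fin n) ℝ) :
    Complex.ofRealHom.mapMatrix A ≤ Complex.ofRealHom.mapMatrix B ↔ A ≤ B := by
  rw [Matrix.le_iff, Matrix.le_iff, ← map_sub]
  exact posSemidef_map_ofReal_iff (B - A)

/-- Together with `map_ofReal_le_iff`, this carries an inequality of exponentials to complex
matrices, where `CFC.log_le_log` applies. -/
theorem mapMatrix_ofReal_exp (A : Matrix (Fin n) (Fin n) ℝ) :
    Complex.ofRealHom.mapMatrix (exp A) = exp (Complex.ofRealHom.mapMatrix A) := by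
  let : NormedAlgebra ℚ (Matrix (Fin n) (Fin n) ℝ) := NormedAlgebra.restrictScalars ℚ ℝ _
  exact map_exp (𝔸 := Matrix (Fin n) (Fin n) ℝ) (𝔹 := Matrix (Fin n) (Fin n) ℂ)
    (Complex.ofRealHom.mapMatrix) (continuous_id.matrix_map Complex.continuous_ofReal) A

/-- The logarithm is operator monotone on positive definite real matrices. -/
theorem le_of_exp_le_exp {X Y : Matrix (Fin n) (Fin n) ℝ} (hX : IsSelfAdjoint X)
    (hY : IsSelfAdjoint Y) (h : exp X ≤ exp Y) : X ≤ Y := by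
  rw [← map_ofReal_le_iff, mapMatrix_ofReal_exp, mapMatrix_ofReal_exp] at h
  have key : ∀ {Z : Matrix (Fin n) (Fin n) ℝ}, IsSelfAdjoint Z →
      IsSelfAdjoint (Complex.ofRealHom.mapMatrix Z) := by
    intro Z hZ
    ext i j
    have := congrFun (congrFun hZ i) j
    simpa [Matrix.star_apply] using this
  have hX' := key hX
  have hY' := key hY
  have := CFC.log_le_log h (by
    have h0 : 0 ≤ exp (Complex.ofRealHom.mapMatrix X) := hX'.exp_nonneg
    exact (Matrix.isUnit_exp _).isStrictlyPositive h0)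
  rw [CFC.log_exp _ hX', CFC.log_exp _ hY'] at this
  exact (map_ofReal_le_iff X Y).mp this

theorem norm_le_iff_spectrum {Z : Matrix (Fin n) (Fin n) ℝ} (hZ : IsSelfAdjoint Z) {c : ℝ}
    (hc : 0 ≤ c) : ‖Z‖ ≤ c ↔ ∀ x ∈ spectrum ℝ Z, ‖x‖ ≤ c := by
  have := norm_cfc_le_iff (𝕜 := ℝ) id Z hc
  rwa [cfc_id ℝ Z] at this

theorem norm_le_of_le {Z : Matrix (Fin n) (Fin n) ℝ} (hZ : IsSelfAdjoint Z) {c : ℝ}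
    (hc : 0 ≤ c) (h₁ : Z ≤ algebraMap ℝ _ c) (h₂ : -Z ≤ algebraMap ℝ _ c) : ‖Z‖ ≤ c := by
  rw [norm_le_iff_spectrum hZ hc]
  intro x hx
  have h₂' : algebraMap ℝ _ (-c) ≤ Z := by
    rw [map_neg]; exact neg_le.mp h₂
  exact abs_le.mpr ⟨(algebraMap_le_iff_le_spectrum (a := Z)).mp h₂' x hx,
    (le_algebraMap_iff_spectrum_le (a := Z)).mp h₁ x hx⟩

theorem le_algebraMap_norm {Z : Matrix (Fin n) (Fin n) ℝ} (hZ : IsSelfAdjoint Z) :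
    Z ≤ algebraMap ℝ _ ‖Z‖ := by
  rw [le_algebraMap_iff_spectrum_le]
  intro x hx
  exact (le_abs_self x).trans ((norm_le_iff_spectrum hZ (norm_nonneg Z)).mp le_rfl x hx)

theorem exp_add_algebraMap (Y : Matrix (Fin n) (Fin n) ℝ) (r : ℝ) :
    exp (Y + algebraMap ℝ _ r) = Real.exp r • exp Y := by
  rw [Matrix.exp_add_of_commute _ _ (Algebra.commutes r Y).symm,
    Algebra.algebraMap_eq_smul_one, Real.exp_eq_exp_ℝ]
  have : exp (r • (1 : Matrix (Fin n) (Fin n) ℝ)) = exp r • 1 := by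
    have := Matrix.exp_diagonal (fun _ : Fin n => r)
    rw [← Matrix.smul_one_eq_diagonal, Pi.exp_def] at this
    rw [this, Matrix.smul_one_eq_diagonal]
  rw [this, mul_smul_comm, mul_one]

/-- Two Hermitian matrices whose exponentials are within a factor `exp r` of each other in the
Loewner order are within distance `r`. -/
theorem norm_sub_le_of_exp_le {X Y : Matrix (Fin n) (Fin n) ℝ} (hX : IsSelfAdjoint X)
    (hY : IsSelfAdjoint Y) {r : ℝ} (hr : 0 ≤ r) (h₁ : exp X ≤ Real.exp r • exp Y)
    (h₂ : exp Y ≤ Real.exp r • exp X) : ‖X - Y‖ ≤ r := by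
  have hra : IsSelfAdjoint (algebraMap ℝ (Matrix (Fin n) (Fin n) ℝ) r) :=
    (IsSelfAdjoint.all r).algebraMap _
  rw [← exp_add_algebraMap] at h₁ h₂
  refine norm_le_of_le (hX.sub hY) hr ?_ ?_
  · exact sub_le_iff_le_add'.mpr (le_of_exp_le_exp hX (hY.add hra) h₁)
  · rw [neg_sub]
    exact sub_le_iff_le_add'.mpr (le_of_exp_le_exp hY (hX.add hra) h₂)

/-! ### Exponentials of skew matrices -/

theorem star_exp_of_skew {K : Matrix (Fin n) (Fin n) ℝ} (hK : star K = -K) :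
    star (exp K) = exp (-K) := by
  rw [← hK]; exact (Matrix.exp_conjTranspose K).symm

theorem exp_mul_exp_neg (K : Matrix (Fin n) (Fin n) ℝ) : exp K * exp (-K) = 1 := by
  rw [← Matrix.exp_add_of_commute _ _ (Commute.refl K).neg_right, add_neg_cancel]
  exact exp_zero

theorem exp_neg_mul_exp (K : Matrix (Fin n) (Fin n) ℝ) : exp (-K) * exp K = 1 := by
  simpa using exp_mul_exp_neg (-K)

/-- Equality fails for `n = 0`, where the norm is `0`. -/
theorem norm_one_le : ‖(1 : Matrix (Fin n) (Fin n) ℝ)‖ ≤ 1 := by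
  have := Matrix.l2_opNorm_diagonal (𝕜 := ℝ) (fun _ : Fin n => (1 : ℝ))
  rw [Matrix.diagonal_one] at this
  rw [this]
  exact (pi_norm_const_le _).trans (by simp)

theorem norm_exp_of_skew_le {K : Matrix (Fin n) (Fin n) ℝ} (hK : star K = -K) :
    ‖exp K‖ ≤ 1 := by
  have h : ‖star (exp K) * exp K‖ = ‖exp K‖ * ‖exp K‖ := CStarRing.norm_star_mul_self
  rw [star_exp_of_skew hK, exp_neg_mul_exp] at h
  have := norm_one_le (n := n)
  nlinarith [norm_nonneg (exp K)]

/-- The path `exp (sK) exp ((1-s)L)` runs from `exp L` to `exp K`; its derivative is `K - L` between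
two factors of norm at most 1. -/
theorem norm_exp_sub_exp_of_skew_le {K L : Matrix (Fin n) (Fin n) ℝ} (hK : star K = -K)
    (hL : star L = -L) : ‖exp K - exp L‖ ≤ ‖K - L‖ := by
  have skew : ∀ {M : Matrix (Fin n) (Fin n) ℝ} (s : ℝ), star M = -M →
      star (s • M) = -(s • M) := by
    intro M s hM
    rw [star_smul, hM, star_trivial, smul_neg]
  have hd : ∀ s : ℝ, HasDerivAt (fun s : ℝ => exp (s • K) * exp ((1 - s) • L))
      (exp (s • K) * (K - L) * exp ((1 - s) • L)) s := by
    intro s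
    have h₁ := hasDerivAt_exp_smul_const (𝕂 := ℝ) K s
    have h₂ := (hasDerivAt_exp_smul_const' (𝕂 := ℝ) L (1 - s)).scomp s
      ((hasDerivAt_id s).const_sub 1)
    convert! h₁.mul h₂ using 1
    simp only [neg_smul, one_smul, Function.comp]
    noncomm_ring
  have := norm_image_sub_le_of_norm_deriv_le_segment_01'
    (f := fun s : ℝ => exp (s • K) * exp ((1 - s) • L)) (C := ‖K - L‖)
    (fun s _ => (hd s).hasDerivWithinAt) (fun s _ => by
      calc _ ≤ ‖exp (s • K)‖ * ‖K - L‖ * ‖exp ((1 - s) • L)‖ :=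
            (norm_mul_le _ _).trans (mul_le_mul_of_nonneg_right (norm_mul_le _ _) (norm_nonneg _))
        _ ≤ 1 * ‖K - L‖ * 1 := by
            gcongr
            · exact norm_exp_of_skew_le (skew s hK)
            · exact norm_exp_of_skew_le (skew (1 - s) hL)
        _ = ‖K - L‖ := by ring)
  simpa using this

/-! ### Extreme eigenvalues and the commutator norm -/

theorem isSelfAdjoint_iff_isSymm {X : Matrix (Fin n) (Fin n) ℝ} :
    IsSelfAdjoint X ↔ X.IsSymm := by
  rw [IsSelfAdjoint, Matrix.star_eq_conjTranspose,
    Matrix.conjTranspose_eq_transpose_of_trivial, Matrix.IsSymm]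

theorem spectrum_nonempty [Nonempty (Fin n)] {P : Matrix (Fin n) (Fin n) ℝ}
    (hP : P.PosDef) : (spectrum ℝ P).Nonempty := by
  rw [hP.1.spectrum_real_eq_range_eigenvalues]
  exact Set.range_nonempty _

theorem spectrum_pos {P : Matrix (Fin n) (Fin n) ℝ} (hP : P.PosDef) {x : ℝ}
    (hx : x ∈ spectrum ℝ P) : 0 < x := by
  rw [hP.1.spectrum_real_eq_range_eigenvalues] at hx
  obtain ⟨i, rfl⟩ := hx
  exact hP.eigenvalues_pos i

theorem lambdaMin_pos [Nonempty (Fin n)] {P : Matrix (Fin n) (Fin n) ℝ}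
    (hP : P.PosDef) : 0 < lambdaMin P :=
  spectrum_pos hP ((spectrum_nonempty hP).csInf_mem P.finite_real_spectrum)

theorem lambdaMin_le {P : Matrix (Fin n) (Fin n) ℝ} {x : ℝ} (hx : x ∈ spectrum ℝ P) :
    lambdaMin P ≤ x :=
  csInf_le P.finite_real_spectrum.bddBelow hx

theorem le_lambdaMax {P : Matrix (Fin n) (Fin n) ℝ} {x : ℝ} (hx : x ∈ spectrum ℝ P) :
    x ≤ lambdaMax P :=
  le_csSup P.finite_real_spectrum.bddAbove hx

theorem lambdaMax_pos [Nonempty (Fin n)] {P : Matrix (Fin n) (Fin n) ℝ}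
    (hP : P.PosDef) : 0 < lambdaMax P :=
  spectrum_pos hP ((spectrum_nonempty hP).csSup_mem P.finite_real_spectrum)

theorem algebraMap_lambdaMin_le {P : Matrix (Fin n) (Fin n) ℝ} (hP : P.PosDef) :
    algebraMap ℝ _ (lambdaMin P) ≤ P := by
  have : IsSelfAdjoint P := hP.1
  exact (algebraMap_le_iff_le_spectrum (a := P)).mpr fun x hx => lambdaMin_le hx

theorem norm_le_lambdaMax [Nonempty (Fin n)] {P : Matrix (Fin n) (Fin n) ℝ}
    (hP : P.PosDef) : ‖P‖ ≤ lambdaMax P := by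
  rw [norm_le_iff_spectrum hP.1 (lambdaMax_pos hP).le]
  intro x hx
  rw [Real.norm_of_nonneg (spectrum_pos hP hx).le]
  exact le_lambdaMax hx

theorem norm_inv_le [Nonempty (Fin n)] {P : Matrix (Fin n) (Fin n) ℝ}
    (hP : P.PosDef) : ‖P⁻¹‖ ≤ (lambdaMin P)⁻¹ := by
  rw [norm_le_iff_spectrum hP.inv.1 (inv_nonneg.mpr (lambdaMin_pos hP).le)]
  intro x hx
  have hx0 := spectrum_pos hP.inv hx
  rw [Real.norm_of_nonneg hx0.le]
  refine le_inv_of_le_inv₀ (lambdaMin_pos hP) (lambdaMin_le ?_)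
  have hu := hP.isUnit
  have := (spectrum.inv_mem_iff (r := Units.mk0 x hx0.ne') (a := hu.unit⁻¹)).mp (by
    simpa using hx)
  simpa using this

theorem norm_commutator_le {P X : Matrix (Fin n) (Fin n) ℝ} (hX : X.IsSymm) :
    ‖P * X - X * P‖ ≤ commNorm P * ‖X‖ := by
  by_cases h : X = 0
  · simp [h]
  rw [← div_le_iff₀ (norm_pos_iff.mpr h), norm_sub_rev]
  exact le_csSup (bddAbove_commQuotients P) ⟨X, hX, h, rfl⟩

theorem commNorm_nonneg (P : Matrix (Fin n) (Fin n) ℝ) : 0 ≤ commNorm P :=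
  Real.sSup_nonneg (by rintro r ⟨D, -, -, rfl⟩; positivity)

theorem mul_lt_of_lt_alphaBound [Nonempty (Fin n)] {P R : Matrix (Fin n) (Fin n) ℝ}
    (hP : P.PosDef) (hR : R.PosDef) {α : ℝ} (hα : ENNReal.ofReal |α| < alphaBound P R) :
    |α| * (commNorm P * lambdaMax R) < lambdaMin P * lambdaMin R := by
  have hpos := mul_pos (lambdaMin_pos hP) (lambdaMin_pos hR)
  -- A zero denominator is allowed here: the product form then reads `0 < λmin(P) λmin(R)`.
  rw [alphaBound, ENNReal.lt_div_iff_mul_lt (Or.inr ENNReal.ofReal_ne_top)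
    (Or.inl ENNReal.ofReal_ne_top), ← ENNReal.ofReal_mul (abs_nonneg α),
    ENNReal.ofReal_lt_ofReal_iff hpos] at hα
  exact hα

/-! ### The rotated target -/

/-- The orthogonal matrix `exp (α [P, X])`. -/
noncomputable def rotation (α : ℝ) (P X : Matrix (Fin n) (Fin n) ℝ) : Matrix (Fin n) (Fin n) ℝ :=
  exp (α • (P * X - X * P))

theorem star_smul_commutator (α : ℝ) {P X : Matrix (Fin n) (Fin n) ℝ} (hP : IsSelfAdjoint P)
    (hX : IsSelfAdjoint X) : star (α • (P * X - X * P)) = -(α • (P * X - X * P)) := by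
  rw [star_smul, star_sub, star_mul, star_mul, hP, hX, star_trivial, ← smul_neg, neg_sub]

theorem star_rotation (α : ℝ) {P X : Matrix (Fin n) (Fin n) ℝ} (hP : IsSelfAdjoint P)
    (hX : IsSelfAdjoint X) : star (rotation α P X) = exp (α • (X * P - P * X)) := by
  rw [rotation, star_exp_of_skew (star_smul_commutator α hP hX), ← smul_neg, neg_sub]

theorem star_rotation_mul_self (α : ℝ) {P X : Matrix (Fin n) (Fin n) ℝ} (hP : IsSelfAdjoint P)
    (hX : IsSelfAdjoint X) : star (rotation α P X) * rotation α P X = 1 := by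
  rw [rotation, star_exp_of_skew (star_smul_commutator α hP hX), exp_neg_mul_exp]

theorem rotation_mul_star_self (α : ℝ) {P X : Matrix (Fin n) (Fin n) ℝ} (hP : IsSelfAdjoint P)
    (hX : IsSelfAdjoint X) : rotation α P X * star (rotation α P X) = 1 := by
  rw [rotation, star_exp_of_skew (star_smul_commutator α hP hX), exp_mul_exp_neg]

theorem norm_rotation_le (α : ℝ) {P X : Matrix (Fin n) (Fin n) ℝ} (hP : IsSelfAdjoint P)
    (hX : IsSelfAdjoint X) : ‖rotation α P X‖ ≤ 1 :=
  norm_exp_of_skew_le (star_smul_commutator α hP hX)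

theorem norm_rotation_sub_le (α : ℝ) {P X Y : Matrix (Fin n) (Fin n) ℝ} (hP : IsSelfAdjoint P)
    (hX : IsSelfAdjoint X) (hY : IsSelfAdjoint Y) :
    ‖rotation α P X - rotation α P Y‖ ≤ |α| * (commNorm P * ‖X - Y‖) := by
  refine (norm_exp_sub_exp_of_skew_le (star_smul_commutator α hP hX)
    (star_smul_commutator α hP hY)).trans ?_
  have : α • (P * X - X * P) - α • (P * Y - Y * P) = α • (P * (X - Y) - (X - Y) * P) := by
    rw [← smul_sub]; congr 1; noncomm_ring
  rw [this, norm_smul, Real.norm_eq_abs]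
  exact mul_le_mul_of_nonneg_left
    (norm_commutator_le (isSelfAdjoint_iff_isSymm.mp (hX.sub hY))) (abs_nonneg α)

/-- The target covariance `R` seen in the frame rotated by `exp (α [P, X])`. -/
noncomputable def rotatedTarget (α : ℝ) (P R X : Matrix (Fin n) (Fin n) ℝ) : Matrix (Fin n) (Fin n) ℝ :=
  star (rotation α P X) * R * rotation α P X

theorem norm_rotatedTarget_sub_le (α : ℝ) {P R X Y : Matrix (Fin n) (Fin n) ℝ}
    (hP : IsSelfAdjoint P) (hX : IsSelfAdjoint X) (hY : IsSelfAdjoint Y) :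
    ‖rotatedTarget α P R X - rotatedTarget α P R Y‖
      ≤ 2 * ‖R‖ * (|α| * (commNorm P * ‖X - Y‖)) := by
  have hUV := norm_rotation_sub_le α hP hX hY
  have hU := norm_rotation_le α hP hX
  have hV := norm_rotation_le α hP hY
  rw [rotatedTarget, rotatedTarget]
  set U := rotation α P X
  set V := rotation α P Y
  have e : star U * R * U - star V * R * V = star (U - V) * R * U + star V * R * (U - V) := by
    rw [star_sub]; noncomm_ring
  have h₁ : ‖star (U - V) * R * U‖ ≤ ‖U - V‖ * ‖R‖ * 1 := by
    refine (norm_mul_le _ _).trans (mul_le_mul ((norm_mul_le _ _).trans ?_) hU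
      (norm_nonneg _) (by positivity))
    rw [norm_star]
  have h₂ : ‖star V * R * (U - V)‖ ≤ 1 * ‖R‖ * ‖U - V‖ := by
    refine (norm_mul_le _ _).trans (mul_le_mul_of_nonneg_right ((norm_mul_le _ _).trans ?_)
      (norm_nonneg _))
    rw [norm_star]
    exact mul_le_mul_of_nonneg_right hV (norm_nonneg _)
  rw [e]
  refine (norm_add_le _ _).trans ((add_le_add h₁ h₂).trans ?_)
  have := mul_le_mul_of_nonneg_left hUV (norm_nonneg R)
  linarith

theorem isSelfAdjoint_rotatedTarget (α : ℝ) (P X : Matrix (Fin n) (Fin n) ℝ)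
    {R : Matrix (Fin n) (Fin n) ℝ} (hR : IsSelfAdjoint R) :
    IsSelfAdjoint (rotatedTarget α P R X) := hR.conjugate' _

theorem algebraMap_lambdaMin_le_rotatedTarget (α : ℝ) {P R X : Matrix (Fin n) (Fin n) ℝ}
    (hP : IsSelfAdjoint P) (hR : R.PosDef) (hX : IsSelfAdjoint X) :
    algebraMap ℝ _ (lambdaMin R) ≤ rotatedTarget α P R X := by
  have := star_left_conjugate_le_conjugate (algebraMap_lambdaMin_le hR) (rotation α P X)
  rwa [← Algebra.commutes, mul_assoc, star_rotation_mul_self α hP hX, mul_one] at this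

/-- The floor `λmin(R)` under the rotated target absorbs the additive error `δ` into a factor `1 + δ
/ λmin(R)`, and `1 + x ≤ exp x` gives the form `norm_sub_le_of_exp_le` needs. -/
theorem rotatedTarget_le (α : ℝ) [Nonempty (Fin n)] {P R X Y : Matrix (Fin n) (Fin n) ℝ}
    (hP : IsSelfAdjoint P) (hR : R.PosDef) (hX : IsSelfAdjoint X) (hY : IsSelfAdjoint Y) :
    rotatedTarget α P R X ≤ Real.exp (2 * ‖R‖ * (|α| * (commNorm P * ‖X - Y‖)) / lambdaMin R) •
      rotatedTarget α P R Y := by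
  have hl := lambdaMin_pos hR
  have hδ := norm_rotatedTarget_sub_le (R := R) α hP hX hY
  set δ := 2 * ‖R‖ * (|α| * (commNorm P * ‖X - Y‖))
  have hδ0 : 0 ≤ δ := (norm_nonneg _).trans hδ
  have hQ := algebraMap_lambdaMin_le_rotatedTarget α hP hR hY
  have hsub := le_algebraMap_norm ((isSelfAdjoint_rotatedTarget α P X hR.1).sub
    (isSelfAdjoint_rotatedTarget α P Y hR.1))
  set Q := rotatedTarget α P R X
  set Q' := rotatedTarget α P R Y
  have hQ0 : 0 ≤ Q' := (algebraMap_nonneg _ hl.le).trans hQ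
  calc Q ≤ algebraMap ℝ _ ‖Q - Q'‖ + Q' := sub_le_iff_le_add.mp hsub
    _ ≤ algebraMap ℝ _ δ + Q' := by gcongr
    _ = (δ / lambdaMin R) • algebraMap ℝ _ (lambdaMin R) + Q' := by
        rw [Algebra.smul_def, ← map_mul, div_mul_cancel₀ _ hl.ne']
    _ ≤ (δ / lambdaMin R) • Q' + Q' := by
        gcongr
    _ = (δ / lambdaMin R + 1) • Q' := by rw [add_smul, one_smul]
    _ ≤ Real.exp (δ / lambdaMin R) • Q' :=
        smul_le_smul_of_nonneg_right (Real.add_one_le_exp _) hQ0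

/-! ### Reduction to a fixed point -/

theorem exists_sqrt {P : Matrix (Fin n) (Fin n) ℝ} (hP : P.PosDef) :
    ∃ S T : Matrix (Fin n) (Fin n) ℝ, IsSelfAdjoint S ∧ IsSelfAdjoint T ∧ S * S = P ∧
      T * T = P⁻¹ ∧ S * T = 1 ∧ T * S = 1 := by
  have hP0 : 0 ≤ P := hP.posSemidef.nonneg
  have hS : IsSelfAdjoint (CFC.sqrt P) := (CFC.sqrt_nonneg P).isSelfAdjoint
  have hSS : CFC.sqrt P * CFC.sqrt P = P := CFC.sqrt_mul_sqrt_self P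
  have hu : IsUnit (CFC.sqrt P).det := by
    have := (Matrix.isUnit_iff_isUnit_det P).mp hP.isUnit
    rw [← hSS, Matrix.det_mul] at this
    exact isUnit_of_mul_isUnit_left this
  refine ⟨CFC.sqrt P, (CFC.sqrt P)⁻¹, hS, Matrix.IsHermitian.inv hS, hSS, ?_,
    Matrix.mul_nonsing_inv _ hu, Matrix.nonsing_inv_mul _ hu⟩
  rw [← Matrix.mul_inv_rev, hSS]

theorem exp_conj_of_inverse {S T : Matrix (Fin n) (Fin n) ℝ} (hST : S * T = 1)
    (A : Matrix (Fin n) (Fin n) ℝ) : exp (S * A * T) = S * exp A * T := by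
  have hT : S⁻¹ = T := Matrix.inv_eq_right_inv hST
  have hu : IsUnit S := (Matrix.isUnit_iff_isUnit_det S).mpr
    (Matrix.isUnit_det_of_right_inverse hST)
  rw [← hT, Matrix.exp_conj S A hu]

theorem hMap_eq_rotation (α : ℝ) {P X : Matrix (Fin n) (Fin n) ℝ} (hP : IsSelfAdjoint P)
    (hX : IsSelfAdjoint X) : hMap α P X =
      rotation α P X * (exp (-(P * X)) * P * exp (-(X * P))) * star (rotation α P X) := by
  rw [hMap, star_rotation α hP hX, rotation]
  noncomm_ring

theorem hMap_eq_iff_rotatedTarget (α : ℝ) {P R X : Matrix (Fin n) (Fin n) ℝ}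
    (hP : IsSelfAdjoint P) (hX : IsSelfAdjoint X) :
    hMap α P X = R ↔ exp (-(P * X)) * P * exp (-(X * P)) = rotatedTarget α P R X := by
  have h₁ := star_rotation_mul_self α hP hX
  have h₂ := rotation_mul_star_self α hP hX
  rw [hMap_eq_rotation α hP hX, rotatedTarget]
  set U := rotation α P X
  constructor
  · rintro rfl
    simp only [mul_assoc, h₁, mul_one]
    simp only [← mul_assoc, h₁, one_mul]
  · intro h
    rw [h]
    simp only [mul_assoc, h₂, mul_one]
    simp only [← mul_assoc, h₂, one_mul]

/-- `PX` and `XP` are similar, through `S` and `T`, to the same matrix `SXS`, so the inner square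
roots cancel. -/
theorem geodesic_eq {P X S T : Matrix (Fin n) (Fin n) ℝ} (hS : S * S = P) (hST : S * T = 1)
    (hTS : T * S = 1) :
    exp (-(P * X)) * P * exp (-(X * P)) = S * exp ((-2 : ℝ) • (S * X * S)) * S := by
  have e₁ : -(P * X) = S * (-(S * X * S)) * T := by
    rw [← hS, mul_neg, neg_mul]
    simp only [mul_assoc, hST, mul_one]
  have e₂ : -(X * P) = T * (-(S * X * S)) * S := by
    rw [← hS, mul_neg, neg_mul]
    simp only [← mul_assoc, hTS, one_mul]
  have e₃ : (-2 : ℝ) • (S * X * S) = -(S * X * S) + -(S * X * S) := by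
    rw [neg_smul, two_smul, neg_add]
  rw [e₁, e₂, exp_conj_of_inverse hST, exp_conj_of_inverse hTS, e₃,
    Matrix.exp_add_of_commute _ _ (Commute.refl _), ← hS]
  set E := exp (-(S * X * S))
  calc S * E * T * (S * S) * (T * E * S) = S * E * (T * S) * (S * T) * E * S := by noncomm_ring
    _ = S * (E * E) * S := by rw [hTS, hST]; noncomm_ring

theorem conj_eq_iff {S T A B : Matrix (Fin n) (Fin n) ℝ} (hST : S * T = 1) (hTS : T * S = 1) :
    S * A * S = B ↔ A = T * B * T := by
  constructor
  · rintro rfl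
    calc A = (T * S) * A * (S * T) := by rw [hTS, hST, one_mul, mul_one]
      _ = _ := by noncomm_ring
  · rintro rfl
    calc _ = (S * T) * B * (T * S) := by noncomm_ring
      _ = B := by rw [hTS, hST, one_mul, mul_one]

/-- The map whose symmetric fixed points are the co-states steering `P = T⁻²` to `R`. -/
noncomputable def steeringMap (α : ℝ) (P R T X : Matrix (Fin n) (Fin n) ℝ) :
    Matrix (Fin n) (Fin n) ℝ :=
  (-(1 / 2) : ℝ) • (T * CFC.log (T * rotatedTarget α P R X * T) * T)

theorem isSelfAdjoint_steeringMap (α : ℝ) {P R T X : Matrix (Fin n) (Fin n) ℝ}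
    (hT : IsSelfAdjoint T) : IsSelfAdjoint (steeringMap α P R T X) := by
  have h : IsSelfAdjoint (T * CFC.log (T * rotatedTarget α P R X * T) * T) := by
    have := (IsSelfAdjoint.log (a := T * rotatedTarget α P R X * T)).conjugate T
    rwa [hT.star_eq] at this
  exact (IsSelfAdjoint.all (-(1 / 2) : ℝ)).smul h

theorem posDef_rotatedTarget (α : ℝ) (P X : Matrix (Fin n) (Fin n) ℝ)
    {R : Matrix (Fin n) (Fin n) ℝ} (hR : R.PosDef) :
    (rotatedTarget α P R X).PosDef := by
  refine hR.conjTranspose_mul_mul_same ?_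
  exact Matrix.mulVec_injective_of_isUnit (Matrix.isUnit_exp _)

theorem posDef_conj {T B : Matrix (Fin n) (Fin n) ℝ} (hT : IsSelfAdjoint T) (hu : IsUnit T)
    (hB : B.PosDef) : (T * B * T).PosDef := by
  have := hB.conjTranspose_mul_mul_same (Matrix.mulVec_injective_of_isUnit hu)
  rwa [← Matrix.star_eq_conjTranspose, hT.star_eq] at this

theorem exp_log_of_posDef {A : Matrix (Fin n) (Fin n) ℝ} (hA : A.PosDef) :
    exp (CFC.log A) = A :=
  CFC.exp_log A hA.isStrictlyPositive

theorem hMap_eq_iff_steeringMap (α : ℝ) {P R S T X : Matrix (Fin n) (Fin n) ℝ}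
    (hP : IsSelfAdjoint P) (hR : R.PosDef) (hS : IsSelfAdjoint S) (hT : IsSelfAdjoint T)
    (hSS : S * S = P) (hST : S * T = 1) (hTS : T * S = 1) (hX : IsSelfAdjoint X) :
    hMap α P X = R ↔ steeringMap α P R T X = X := by
  have hu : IsUnit T := IsUnit.of_mul_eq_one S hTS
  have hA := posDef_conj hT hu (posDef_rotatedTarget α P X hR)
  have hSXS : IsSelfAdjoint ((-2 : ℝ) • (S * X * S)) := by
    have := hX.conjugate S
    rw [hS.star_eq] at this
    exact (IsSelfAdjoint.all (-2 : ℝ)).smul this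
  rw [hMap_eq_iff_rotatedTarget α hP hX, geodesic_eq hSS hST hTS, conj_eq_iff hST hTS,
    steeringMap]
  set A := T * rotatedTarget α P R X * T
  have h₁ : exp ((-2 : ℝ) • (S * X * S)) = A ↔ (-2 : ℝ) • (S * X * S) = CFC.log A :=
    ⟨fun h => by rw [← h, CFC.log_exp _ hSXS], fun h => by rw [h, exp_log_of_posDef hA]⟩
  have h₂ : (-2 : ℝ) • (S * X * S) = CFC.log A ↔ S * X * S = (-(1 / 2) : ℝ) • CFC.log A := by
    constructor
    · intro h; rw [← h, smul_smul]; norm_num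
    · intro h; rw [h, smul_smul]; norm_num
  rw [h₁, h₂, conj_eq_iff hST hTS, mul_smul_comm, smul_mul_assoc, eq_comm]

/-! ### Contraction and the first bound -/

theorem norm_steeringMap_sub_le [Nonempty (Fin n)] (α : ℝ)
    {P R T X Y : Matrix (Fin n) (Fin n) ℝ} (hP : P.PosDef) (hR : R.PosDef)
    (hT : IsSelfAdjoint T) (hTT : T * T = P⁻¹) (hu : IsUnit T) (hX : IsSelfAdjoint X)
    (hY : IsSelfAdjoint Y) :
    ‖steeringMap α P R T X - steeringMap α P R T Y‖ ≤
      |α| * (commNorm P * lambdaMax R) / (lambdaMin P * lambdaMin R) * ‖X - Y‖ := by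
  have hlP := lambdaMin_pos hP
  have hlR := lambdaMin_pos hR
  have conj_le : ∀ {V W : Matrix (Fin n) (Fin n) ℝ}, IsSelfAdjoint V → IsSelfAdjoint W →
      T * rotatedTarget α P R V * T ≤
        Real.exp (2 * ‖R‖ * (|α| * (commNorm P * ‖V - W‖)) / lambdaMin R) •
          (T * rotatedTarget α P R W * T) := by
    intro V W hV hW
    have := star_left_conjugate_le_conjugate (rotatedTarget_le α hP.1 hR hV hW) T
    rwa [hT.star_eq, mul_smul_comm, smul_mul_assoc] at this
  have hlog : ‖CFC.log (T * rotatedTarget α P R X * T)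
      - CFC.log (T * rotatedTarget α P R Y * T)‖
        ≤ 2 * ‖R‖ * (|α| * (commNorm P * ‖X - Y‖)) / lambdaMin R := by
    have hc := commNorm_nonneg P
    apply norm_sub_le_of_exp_le .log .log (by positivity)
    · rw [exp_log_of_posDef (posDef_conj hT hu (posDef_rotatedTarget α P X hR)),
        exp_log_of_posDef (posDef_conj hT hu (posDef_rotatedTarget α P Y hR))]
      exact conj_le hX hY
    · rw [exp_log_of_posDef (posDef_conj hT hu (posDef_rotatedTarget α P X hR)),
        exp_log_of_posDef (posDef_conj hT hu (posDef_rotatedTarget α P Y hR)),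
        norm_sub_rev X Y]
      exact conj_le hY hX
  have hTn : ‖T‖ * ‖T‖ ≤ (lambdaMin P)⁻¹ := by
    rw [← CStarRing.norm_star_mul_self, hT.star_eq, hTT]
    exact norm_inv_le hP
  rw [steeringMap, steeringMap]
  set Z := CFC.log (T * rotatedTarget α P R X * T)
  set Z' := CFC.log (T * rotatedTarget α P R Y * T)
  have e : (-(1 / 2) : ℝ) • (T * Z * T) - (-(1 / 2) : ℝ) • (T * Z' * T)
      = (-(1 / 2) : ℝ) • (T * (Z - Z') * T) := by
    rw [← smul_sub]; congr 1; noncomm_ring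
  have hc := commNorm_nonneg P
  calc _ = 1 / 2 * ‖T * (Z - Z') * T‖ := by
        rw [e, norm_smul]; norm_num
    _ ≤ 1 / 2 * (‖T‖ * ‖Z - Z'‖ * ‖T‖) := by
        gcongr
        exact (norm_mul_le _ _).trans
          (mul_le_mul_of_nonneg_right (norm_mul_le _ _) (norm_nonneg _))
    _ = 1 / 2 * (‖T‖ * ‖T‖ * ‖Z - Z'‖) := by ring
    -- The 2 from varying both rotations cancels the 1/2, leaving exactly the constant of
    -- `alphaBound`.
    _ ≤ 1 / 2 * ((lambdaMin P)⁻¹ *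
          (2 * lambdaMax R * (|α| * (commNorm P * ‖X - Y‖)) / lambdaMin R)) := by
        gcongr
        refine hlog.trans ?_
        gcongr
        exact norm_le_lambdaMax hR
    _ = _ := by
        field_simp

theorem existsUnique_hMap_eq [Nonempty (Fin n)] {P R : Matrix (Fin n) (Fin n) ℝ}
    (hP : P.PosDef) (hR : R.PosDef) {α : ℝ} (hα : ENNReal.ofReal |α| < alphaBound P R) :
    ∃! X : Matrix (Fin n) (Fin n) ℝ, X.IsSymm ∧ hMap α P X = R := by
  obtain ⟨S, T, hS, hT, hSS, hTT, hST, hTS⟩ := exists_sqrt hP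
  have hu : IsUnit T := IsUnit.of_mul_eq_one S hTS
  have hpos := mul_pos (lambdaMin_pos hP) (lambdaMin_pos hR)
  have hκ1 : |α| * (commNorm P * lambdaMax R) / (lambdaMin P * lambdaMin R) < 1 :=
    (div_lt_one hpos).mpr (mul_lt_of_lt_alphaBound hP hR hα)
  have hκ0 : 0 ≤ |α| * (commNorm P * lambdaMax R) / (lambdaMin P * lambdaMin R) :=
    div_nonneg (mul_nonneg (abs_nonneg _)
      (mul_nonneg (commNorm_nonneg P) (lambdaMax_pos hR).le)) hpos.le
  have hlip := fun {X Y : Matrix (Fin n) (Fin n) ℝ} (hX : IsSelfAdjoint X)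
    (hY : IsSelfAdjoint Y) => norm_steeringMap_sub_le α hP hR hT hTT hu hX hY
  set κ := |α| * (commNorm P * lambdaMax R) / (lambdaMin P * lambdaMin R)
  have hiff := fun {X : Matrix (Fin n) (Fin n) ℝ} (hX : IsSelfAdjoint X) =>
    hMap_eq_iff_steeringMap α hP.1 hR hS hT hSS hST hTS hX
  have hcomplete : IsComplete {X : Matrix (Fin n) (Fin n) ℝ | IsSelfAdjoint X} :=
    (isClosed_eq continuous_star continuous_id).isComplete
  have hmaps : Set.MapsTo (steeringMap α P R T) {X | IsSelfAdjoint X} {X | IsSelfAdjoint X} :=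
    fun X _ => isSelfAdjoint_steeringMap α hT
  have hF : ContractingWith ⟨κ, hκ0⟩ (hmaps.restrict _ _ _) := by
    refine ⟨by exact_mod_cast hκ1, LipschitzWith.of_dist_le_mul fun X Y => ?_⟩
    rw [Subtype.dist_eq, Subtype.dist_eq, dist_eq_norm, dist_eq_norm]
    exact hlip X.2 Y.2
  obtain ⟨X, hX, hfix, -⟩ := ContractingWith.exists_fixedPoint' hcomplete hmaps hF
    (IsSelfAdjoint.zero _) (edist_ne_top _ _)
  refine ⟨X, ⟨isSelfAdjoint_iff_isSymm.mp hX, (hiff hX).mpr hfix⟩, ?_⟩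
  rintro Y ⟨hY, hYR⟩
  have hY' := isSelfAdjoint_iff_isSymm.mpr hY
  have h := hlip hY' hX
  rw [(hiff hY').mp hYR, hfix] at h
  have h0 : ‖Y - X‖ = 0 := by nlinarith [norm_nonneg (Y - X)]
  exact sub_eq_zero.mp (norm_eq_zero.mp h0)

/-! ### Reversal of endpoints -/

/-- The co-state steering `hMap α P X` back to `P`. -/
noncomputable def reverseCostate (α : ℝ) (P X : Matrix (Fin n) (Fin n) ℝ) :
    Matrix (Fin n) (Fin n) ℝ :=
  -(rotation α P X * (exp (X * P) * X * exp (P * X)) * star (rotation α P X))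

theorem star_exp_mul {P X : Matrix (Fin n) (Fin n) ℝ} (hP : IsSelfAdjoint P)
    (hX : IsSelfAdjoint X) : star (exp (P * X)) = exp (X * P) := by
  have : star (P * X) = X * P := by rw [star_mul, hP, hX]
  rw [← this]; exact (Matrix.exp_conjTranspose (P * X)).symm

theorem isSelfAdjoint_reverseCostate (α : ℝ) {P X : Matrix (Fin n) (Fin n) ℝ}
    (hP : IsSelfAdjoint P) (hX : IsSelfAdjoint X) : IsSelfAdjoint (reverseCostate α P X) := by
  have h := ((hX.conjugate (exp (X * P))).conjugate (rotation α P X)).neg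
  rwa [star_exp_mul hX hP] at h

theorem commute_exp_self (A : Matrix (Fin n) (Fin n) ℝ) : Commute A (exp A) :=
  (Commute.refl A).exp_right

theorem hMap_mul_reverseCostate (α : ℝ) {P X : Matrix (Fin n) (Fin n) ℝ}
    (hP : IsSelfAdjoint P) (hX : IsSelfAdjoint X) :
    hMap α P X * reverseCostate α P X
      = -(rotation α P X * (P * X) * star (rotation α P X)) := by
  have h₁ := star_rotation_mul_self α hP hX
  rw [hMap_eq_rotation α hP hX, reverseCostate, mul_neg]
  set U := rotation α P X
  congr 1
  calc _ = U * (exp (-(P * X)) * P * exp (-(X * P))) * (star U * U) *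
        (exp (X * P) * X * exp (P * X)) * star U := by noncomm_ring
    _ = U * (exp (-(P * X)) * P * (exp (-(X * P)) * exp (X * P)) * X * exp (P * X)) *
        star U := by rw [h₁]; noncomm_ring
    _ = U * (exp (-(P * X)) * ((P * X) * exp (P * X))) * star U := by
        rw [exp_neg_mul_exp]; noncomm_ring
    _ = _ := by
        rw [(commute_exp_self (P * X)).eq, ← mul_assoc (exp _), exp_neg_mul_exp, one_mul]

theorem isSelfAdjoint_hMap (α : ℝ) {P X : Matrix (Fin n) (Fin n) ℝ}
    (hP : IsSelfAdjoint P) (hX : IsSelfAdjoint X) : IsSelfAdjoint (hMap α P X) := by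
  have h := (hP.conjugate (exp (-(P * X)))).conjugate (rotation α P X)
  rw [← neg_mul, star_exp_mul hP.neg hX, mul_neg] at h
  rwa [hMap_eq_rotation α hP hX, ← neg_mul]

theorem reverseCostate_mul_hMap (α : ℝ) {P X : Matrix (Fin n) (Fin n) ℝ}
    (hP : IsSelfAdjoint P) (hX : IsSelfAdjoint X) :
    reverseCostate α P X * hMap α P X
      = -(rotation α P X * (X * P) * star (rotation α P X)) := by
  have h := congrArg star (hMap_mul_reverseCostate α hP hX)
  rw [star_mul, (isSelfAdjoint_hMap α hP hX).star_eq,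
    (isSelfAdjoint_reverseCostate α hP hX).star_eq] at h
  rw [h]
  simp only [star_neg, star_mul, star_star, hP.star_eq, hX.star_eq, mul_assoc]

/-- The commutator of covariance and co-state is reversed. -/
theorem commutator_reverseCostate (α : ℝ) {P X : Matrix (Fin n) (Fin n) ℝ}
    (hP : IsSelfAdjoint P) (hX : IsSelfAdjoint X) :
    α • (hMap α P X * reverseCostate α P X - reverseCostate α P X * hMap α P X)
      = -(α • (P * X - X * P)) := by
  rw [hMap_mul_reverseCostate α hP hX, reverseCostate_mul_hMap α hP hX]
  have h₂ := rotation_mul_star_self α hP hX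
  have hc : Commute (α • (P * X - X * P)) (rotation α P X) := commute_exp_self _
  set U := rotation α P X
  calc _ = -(U * (α • (P * X - X * P)) * star U) := by
        rw [mul_smul_comm, smul_mul_assoc, ← smul_neg]
        congr 1
        noncomm_ring
    -- `U` commutes with its own generator, so conjugation by it has no effect.
    _ = _ := by rw [← hc.eq, mul_assoc, h₂, mul_one]

theorem rotation_reverseCostate (α : ℝ) {P X : Matrix (Fin n) (Fin n) ℝ}
    (hP : IsSelfAdjoint P) (hX : IsSelfAdjoint X) :
    rotation α (hMap α P X) (reverseCostate α P X) = star (rotation α P X) := by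
  rw [rotation, commutator_reverseCostate α hP hX, rotation,
    star_exp_of_skew (star_smul_commutator α hP hX)]

theorem hMap_reverseCostate (α : ℝ) {P X : Matrix (Fin n) (Fin n) ℝ}
    (hP : IsSelfAdjoint P) (hX : IsSelfAdjoint X) :
    hMap α (hMap α P X) (reverseCostate α P X) = P := by
  have h₁ := star_rotation_mul_self α hP hX
  have h₂ := rotation_mul_star_self α hP hX
  rw [hMap_eq_rotation α (isSelfAdjoint_hMap α hP hX) (isSelfAdjoint_reverseCostate α hP hX),
    rotation_reverseCostate α hP hX, hMap_mul_reverseCostate α hP hX,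
    reverseCostate_mul_hMap α hP hX, neg_neg, neg_neg, exp_conj_of_inverse h₂,
    exp_conj_of_inverse h₂, hMap_eq_rotation α hP hX, star_star]
  set U := rotation α P X
  calc _ = (star U * U) * exp (P * X) * (star U * U) * exp (-(P * X)) * P * exp (-(X * P)) *
        (star U * U) * exp (X * P) * (star U * U) := by noncomm_ring
    _ = (exp (P * X) * exp (-(P * X))) * P * (exp (-(X * P)) * exp (X * P)) := by
        rw [h₁]; noncomm_ring
    _ = P := by rw [exp_mul_exp_neg, exp_neg_mul_exp, one_mul, mul_one]

/-- Reversal is an involution; this transfers uniqueness, as `hMap_reverseCostate` transfers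
existence. -/
theorem reverseCostate_reverseCostate (α : ℝ) {P X : Matrix (Fin n) (Fin n) ℝ}
    (hP : IsSelfAdjoint P) (hX : IsSelfAdjoint X) :
    reverseCostate α (hMap α P X) (reverseCostate α P X) = X := by
  have h₁ := star_rotation_mul_self α hP hX
  have h₂ := rotation_mul_star_self α hP hX
  rw [reverseCostate, rotation_reverseCostate α hP hX, hMap_mul_reverseCostate α hP hX,
    reverseCostate_mul_hMap α hP hX, star_star]
  have hneg : ∀ A : Matrix (Fin n) (Fin n) ℝ,
      exp (-(rotation α P X * A * star (rotation α P X)))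
        = rotation α P X * exp (-A) * star (rotation α P X) := by
    intro A
    rw [← exp_conj_of_inverse h₂, mul_neg, neg_mul]
  rw [hneg, hneg, reverseCostate]
  set U := rotation α P X
  calc _ = (star U * U) * exp (-(X * P)) * (star U * U) * exp (X * P) * X * exp (P * X) *
        (star U * U) * exp (-(P * X)) * (star U * U) := by noncomm_ring
    _ = (exp (-(X * P)) * exp (X * P)) * X * (exp (P * X) * exp (-(P * X))) := by
        rw [h₁]; noncomm_ring
    _ = X := by rw [exp_mul_exp_neg, exp_neg_mul_exp, one_mul, mul_one]

theorem existsUnique_hMap_eq_of_reverse {P R : Matrix (Fin n) (Fin n) ℝ}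
    (hP : IsSelfAdjoint P) (hR : IsSelfAdjoint R) {α : ℝ}
    (h : ∃! X : Matrix (Fin n) (Fin n) ℝ, X.IsSymm ∧ hMap α R X = P) :
    ∃! X : Matrix (Fin n) (Fin n) ℝ, X.IsSymm ∧ hMap α P X = R := by
  simp only [← isSelfAdjoint_iff_isSymm] at h ⊢
  obtain ⟨X, ⟨hX, rfl⟩, huniq⟩ := h
  refine ⟨reverseCostate α R X, ⟨isSelfAdjoint_reverseCostate α hR hX,
    hMap_reverseCostate α hR hX⟩, ?_⟩
  rintro Y ⟨hY, hYR⟩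
  have := huniq (reverseCostate α (hMap α R X) Y) ⟨isSelfAdjoint_reverseCostate α hP hY, by
    have := hMap_reverseCostate α hP hY
    rwa [hYR] at this⟩
  rw [← this]
  have h := reverseCostate_reverseCostate α hP hY
  rw [hYR] at h
  exact h.symm

/-! ### Rotating-eigenspace paths -/

/-- The skew part of the initial matrix is `[P, X] / (2ε)`: scaled by `1 + ε` it gives `α [P, X]`,
while its transpose scaled by `ε` completes the symmetric part to `-PX`. -/
theorem transition_one_initialSystem {ε α : ℝ} (hε : ε ≠ 0) (hα : α = (1 + ε) / (2 * ε))
    {P X : Matrix (Fin n) (Fin n) ℝ} (hP : P.IsSymm) (hX : X.IsSymm) :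
    transition ε 1 (initialSystem ε P X) = rotation α P X * exp (-(P * X)) := by
  have hT : (initialSystem ε P X).transpose
      = -((1 / 2 : ℝ) • (P * X + X * P)) + (1 / (2 * ε)) • (X * P - P * X) := by
    simp only [initialSystem, Matrix.transpose_sub, Matrix.transpose_neg, Matrix.transpose_smul,
      Matrix.transpose_add, Matrix.transpose_mul, hP.eq, hX.eq]
    module
  have ha : antiPart (initialSystem ε P X) = (1 / (2 * ε)) • (P * X - X * P) := by
    rw [antiPart, hT, initialSystem]
    module
  have hs : symPart (initialSystem ε P X) = -((1 / 2 : ℝ) • (P * X + X * P)) := by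
    rw [symPart, hT, initialSystem]
    module
  have haT : (antiPart (initialSystem ε P X)).transpose = (1 / (2 * ε)) • (X * P - P * X) := by
    simp only [ha, Matrix.transpose_sub, Matrix.transpose_smul, Matrix.transpose_mul, hP.eq,
      hX.eq]
  rw [transition, haT, ha, hs, rotation, one_smul, mul_one, smul_smul, smul_smul]
  have e₁ : (1 + ε) * (1 / (2 * ε)) = α := by rw [hα]; ring
  have e₂ : ε * (1 / (2 * ε)) = 1 / 2 := by field_simp
  have e₃ : -((1 / 2 : ℝ) • (P * X + X * P)) + (1 / 2 : ℝ) • (X * P - P * X) = -(P * X) := by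
    module
  rw [e₁, e₂, e₃]

theorem transition_one_conj {ε α : ℝ} (hε : ε ≠ 0) (hα : α = (1 + ε) / (2 * ε))
    {P X : Matrix (Fin n) (Fin n) ℝ} (hP : P.IsSymm) (hX : X.IsSymm) :
    transition ε 1 (initialSystem ε P X) * P *
      (transition ε 1 (initialSystem ε P X)).transpose = hMap α P X := by
  have hP' := isSelfAdjoint_iff_isSymm.mpr hP
  have hX' := isSelfAdjoint_iff_isSymm.mpr hX
  rw [transition_one_initialSystem hε hα hP hX, hMap_eq_rotation α hP' hX',
    ← Matrix.conjTranspose_eq_transpose_of_trivial, ← Matrix.star_eq_conjTranspose, star_mul,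
    ← neg_mul, star_exp_mul hP'.neg hX', mul_neg]
  noncomm_ring

theorem existsUnique_isRotationPath {ε α : ℝ} (hε : ε ≠ 0) (hα : α = (1 + ε) / (2 * ε))
    {P R : Matrix (Fin n) (Fin n) ℝ} (hP : P.IsSymm)
    (h : ∃! X : Matrix (Fin n) (Fin n) ℝ, X.IsSymm ∧ hMap α P X = R) :
    ∃! Q : unitInterval → Matrix (Fin n) (Fin n) ℝ, IsRotationPath ε P Q ∧ Q 1 = R := by
  obtain ⟨X, ⟨hX, hXR⟩, huniq⟩ := h
  refine ⟨fun t => transition ε (t : ℝ) (initialSystem ε P X) * P *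
      (transition ε (t : ℝ) (initialSystem ε P X)).transpose, ⟨⟨X, hX, fun _ => rfl⟩, ?_⟩, ?_⟩
  · rw [← hXR, ← transition_one_conj hε hα hP hX]
    simp
  · rintro Q ⟨⟨Y, hY, hQ⟩, hQ1⟩
    have hYX : Y = X := by
      refine huniq Y ⟨hY, ?_⟩
      rw [← hQ1, hQ 1, ← transition_one_conj hε hα hP hY]
      simp
    subst hYX
    exact funext hQ

end CovPath

theorem mainTheorem1 (n : ℕ) (P₀ P₁ : Matrix (Fin n) (Fin n) ℝ) (hP₀ : P₀.PosDef)
    (hP₁ : P₁.PosDef) (α : ℝ)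
    (hα : ENNReal.ofReal |α| < max (CovPath.alphaBound P₀ P₁) (CovPath.alphaBound P₁ P₀)) :
    (∃! X : Matrix (Fin n) (Fin n) ℝ, X.IsSymm ∧ CovPath.hMap α P₀ X = P₁) ∧
    (∀ ε : ℝ, ε ≠ 0 → α = (1 + ε) / (2 * ε) →
      ∃! P : unitInterval → Matrix (Fin n) (Fin n) ℝ,
        CovPath.IsRotationPath ε P₀ P ∧ P 1 = P₁) := by
  have main : ∃! X : Matrix (Fin n) (Fin n) ℝ, X.IsSymm ∧ CovPath.hMap α P₀ X = P₁ := by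
    cases n with
    -- The eigenvalue estimates need a nonempty spectrum; in size 0 there is only one matrix.
    | zero => exact ⟨0, ⟨Subsingleton.elim _ _, Subsingleton.elim _ _⟩,
        fun _ _ => Subsingleton.elim _ _⟩
    | succ m =>
      rcases lt_max_iff.mp hα with h | h
      · exact CovPath.existsUnique_hMap_eq hP₀ hP₁ h
      · exact CovPath.existsUnique_hMap_eq_of_reverse hP₀.1 hP₁.1
          (CovPath.existsUnique_hMap_eq hP₁ hP₀ h)
  exact ⟨main, fun ε hε h => CovPath.existsUnique_isRotationPath hε h
    (CovPath.isSelfAdjoint_iff_isSymm.mp hP₀.1) main⟩
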